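/- Let $P$ be a $d$-polytope (the convex hull of finitely many points of a finite-dimensional real vector space, of dimension $d\ge 0$), with facets $F_1,\dots,F_m$ listed without repetition, and let $\pi$ be an affine map, with $e=\dim\pi(P)$. For a face $G$ of $P$ put $I_P(G)=\{i\in[m] : G\subseteq F_i\}$. A face $G\neq P$ is \emph{strictly preserved} under $\pi$ if (i) $\pi(G)$ is a face of $\pi(P)$ different from $\pi(P)$, (ii) $G$ and $\pi(G)$ have isomorphic face lattices, and (iii) $P\cap\pi^{-1}(\pi(G))=G$. The \emph{strict projection complex} $\mathcal K(P,\pi)\subseteq 2^{[m]}$ is the simplicial complex generated by the sets $[m]\setminus I_P(G)$, where $G$ ranges over the strictly preserved faces. Suppose that every vertex of $P$ is strictly preserved under $\pi$. Then $k:=m-d-2+e\ge 0$, and there is a $(k+1)$-dimensional polytope $\mathcal A=\operatorname{conv}\{a_1,\dots,a_m\}\subset\mathbb R^{k+1}$, whose vertices are exactly the $m$ distinct points $a_1,\dots,a_m$ (the projection polytope), such that the following hold. (a) (Gale duality) There are linear functionals $\ell_i$ and reals $b_i$ with $\ell_i\le b_i$ on $P$ and $F_i=\{x\in P:\ell_i(x)=b_i\}$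 such that the restrictions of $\ell_1,\dots,\ell_m$ to the space $L$ of vectors that are parallel to the affine span of $P$ and annihilated by the linear part of $\pi$ form a Gale transform of $a_1,\dots,a_m$; that is, these restrictions span $L^*$, and for $c\in\mathbb R^m$ one has $\sum_i c_i=0$ and $\sum_i c_ia_i=0$ if and only if there is $\varphi\in (L^*)^*$ with $c_i=\varphi(\ell_i|_L)$ for all $i$. (b) For every strictly preserved face $G$ of $P$, the points $a_i$, $i\in[m]\setminus I_P(G)$, are affinely independent, and their convex hull is a face of $\mathcal A$ different from $\mathcal A$. (c) $\mathcal K(P,\pi)$ is embedded in the polytopal $k$-sphere $\partial\mathcal A$: the boundary $\partial\mathcal A$ is homeomorphic to the sphere $S^{k}$; for every $\tau\in\mathcal K(P,\pi)$ the points $a_i$, $i\in\tau$, are affinely independent and span a face of $\mathcal A$ different from $\mathcal A$; and the map $w\mapsto\sum_i w_ia_i$ (in barycentric coordinates) is a topological embedding of the geometric realization $\|\mathcal K(P,\pi)\|$ into $\partial\mathcal A$. -/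

import Mathlib

open Set Topology

noncomputable section

namespace PolytopeProjection

section Polytopes

variable {E W : Type*} [NormedAddCommGroup E] [NormedSpace ℝ E]
  [NormedAddCommGroup W] [NormedSpace ℝ W]

/-- A (convex) polytope: the convex hull of finitely many points. -/
def IsPolytope (P : Set E) : Prop :=
  ∃ V : Finset E, P = convexHull ℝ (V : Set E)

open Classical in
/-- The dimension of a set is the dimension of its affine span, with `dim ∅ = -1`. -/
def polyDim (S : Set E) : ℤ :=
  if S = ∅ then -1 else (Module.finrank ℝ (vectorSpan ℝ S) : ℤ)

/-- `G` is a face of `P`: the empty set, or the set of maximizers over `P` of a linear functional,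
that is, the intersection of `P` with a supporting hyperplane (the zero functional gives `P`). -/
def IsFace (P G : Set E) : Prop := IsExposed ℝ P G

/-- A proper face is a face different from the whole polytope. -/
def IsProperFace (P G : Set E) : Prop := IsFace P G ∧ G ≠ P

/-- A vertex, viewed as a set: a face of dimension `0`. -/
def IsVertex (P G : Set E) : Prop := IsFace P G ∧ polyDim G = 0

/-- A facet: a face of dimension `dim P - 1`. -/
def IsFacet (P G : Set E) : Prop := IsFace P G ∧ polyDim G = polyDim P - 1

/-- The face lattice: the faces, ordered by inclusion. -/
abbrev FaceLattice (P : Set E) : Type _ := {G : Set E // IsFace P G}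

/-- Two polytopes are combinatorially isomorphic if their face lattices are isomorphic. -/
def CombIso (P : Set E) (Q : Set W) : Prop :=
  Nonempty (FaceLattice P ≃o FaceLattice Q)

/-- The proper face `G` of `P` is strictly preserved under the projection `π : P → π(P)`. -/
structure StrictlyPreserved (P : Set E) (π : E →ᵃ[ℝ] W) (G : Set E) : Prop where
  isProperFace : IsProperFace P G
  image_isProperFace : IsProperFace (π '' P) (π '' G)
  combIso : CombIso G (π '' G)
  preimage_eq : P ∩ π ⁻¹' (π '' G) = G

/-- `F 0, …, F (m - 1)` is an enumeration without repetition of the facets of `P`. -/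
def IsFacetEnumeration {m : ℕ} (P : Set E) (F : Fin m → Set E) : Prop :=
  Function.Injective F ∧ range F = {G | IsFacet P G}

/-- The facet incidences of `G`: the indices of the facets that contain `G`. -/
def facetIncidences {m : ℕ} (F : Fin m → Set E) (G : Set E) : Set (Fin m) :=
  {i | G ⊆ F i}

/-- The inequality `l x ≤ b` is valid on `P` and defines the face `G`. -/
def DefinesFace (P G : Set E) (l : StrongDual ℝ E) (b : ℝ) : Prop :=
  (∀ x ∈ P, l x ≤ b) ∧ G = {x ∈ P | l x = b}

/-- The strict projection complex: the simplicial complex on the facet indices that is generated by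
the complements of the facet incidences of the strictly preserved faces. (In Mathlib's convention
the empty simplex is not listed.) -/
def strictProjectionComplex {m : ℕ} (P : Set E) (π : E →ᵃ[ℝ] W) (F : Fin m → Set E) :
    PreAbstractSimplicialComplex (Fin m) where
  faces := {τ | τ.Nonempty ∧ ∃ G, StrictlyPreserved P π G ∧
    (τ : Set (Fin m)) ⊆ (facetIncidences F G)ᶜ}
  isRelLowerSet_faces := by
    rintro τ ⟨hτ, G, hG, hsub⟩
    refine ⟨hτ, fun σ hσ hne => ⟨hne, G, hG, ?_⟩⟩
    exact (Finset.coe_subset.mpr hσ).trans hsub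

/-- The direction space of the fibres of `π : P → π(P)`: the vectors parallel to the affine span of
`P` that are annihilated by the linear part of `π`. -/
def fibreDirection (P : Set E) (π : E →ᵃ[ℝ] W) : Submodule ℝ E :=
  vectorSpan ℝ P ⊓ LinearMap.ker π.linear

end Polytopes

/-- `g` is a Gale transform of the point configuration `a` (equivalently, `a` is Gale-dual to `g`):
the vectors `g i` span `V`, and the affine dependencies of `a` are exactly the families of values
on `g` of the linear functionals on `V`. -/
def IsGaleTransform {ι A V : Type*} [Fintype ι] [AddCommGroup A] [Module ℝ A]
    [AddCommGroup V] [Module ℝ V] (a : ι → A) (g : ι → V) : Prop :=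
  Submodule.span ℝ (range g) = ⊤ ∧
    ∀ c : ι → ℝ, (∑ i, c i = 0 ∧ ∑ i, c i • a i = 0) ↔
      ∃ φ : V →ₗ[ℝ] ℝ, ∀ i, c i = φ (g i)

/-- The geometric realization `‖K‖` of a simplicial complex on a finite vertex set, by barycentric
coordinates: the points of the standard simplex whose support is contained in a face of `K`. -/
def realization {ι : Type*} [Fintype ι] (K : PreAbstractSimplicialComplex ι) : Set (ι → ℝ) :=
  {w | w ∈ stdSimplex ℝ ι ∧ ∃ τ ∈ K.faces, ∀ i, w i ≠ 0 → i ∈ τ}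

/-- The points `a i`, `i ∈ J`, are the vertices of a simplex that is a proper face of `A`. -/
def SpansSimplexFace {ι E : Type*} [NormedAddCommGroup E] [NormedSpace ℝ E]
    (A : Set E) (a : ι → E) (J : Set ι) : Prop :=
  IsProperFace A (convexHull ℝ (a '' J)) ∧ AffineIndependent ℝ (fun i : J => a i)

end PolytopeProjection

end

/-!
Let `L` be the fibre direction of the projection and `g i` the restriction to `L` of a normal `l i`
of the facet `F i`. The proof turns strict preservation into a positivity property of the `g i`,
and reads this property off on the Gale dual configuration.

If `G` is a nonempty strictly preserved face, then `u = 0` is the only `u ∈ L` with `g i u ≤ 0` for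
all facets `F i` containing `G`. Indeed, by the facet description of `P`
(`IsPolytope.mem_of_forall_le`) one can move a little in the direction `u` from a relatively
interior point of `G` without leaving `P`. The image under `π` does not change, so one stays in
`P ∩ π⁻¹(π(G)) = G`. But `π` is injective on the affine span of `G`, because the isomorphic face
lattices of `G` and `π(G)` force equal dimensions (`CombIso.polyDim_le`). This is
`StrictlyPreserved.eq_zero_of_forall_le`. By Stiemke's lemma (`exists_pos_dependency`) it yields a
linear dependency of the `g i` that is positive at the facets containing `G` and zero elsewhere.

Applied to all facets at once, the same lemma allows rescaling the normals so that `∑ i, g i = 0`.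
The dependencies of the `g i` then contain the constants, and they are the families of values of
the affine functions at the points `a i` of a Gale dual configuration (`exists_isGaleTransform`).
So the dependency of `G` is an affine function on `A` that supports it exactly along the `a i` with
`F i` not containing `G`. These points are affinely independent: by Gale duality, an affine
dependency among them is given by some `u ∈ L` with `g i u = 0` for all `F i` containing `G`, hence
by `u = 0`. Every facet misses some vertex of `P`, so every `a i` is a vertex of a simplex face of
`A`. For the embedding, let two points of the realization have the same image. The affine function
of a face that supports one of them vanishes at the image, hence on the support of the other; so
both lie on one simplex face, where barycentric coordinates are unique.
-/

namespace PolytopeProjection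

/-! ### Faces of polytopes -/

section Faces

variable {E W : Type*} [NormedAddCommGroup E] [NormedSpace ℝ E]
  [NormedAddCommGroup W] [NormedSpace ℝ W]

/-- The part of a convex hull on a supporting hyperplane is the convex hull of the generators on
that hyperplane. -/
theorem setOf_mem_convexHull_eq {V : Set E} (l : StrongDual ℝ E) {b : ℝ} (hV : ∀ v ∈ V, l v ≤ b) :
    {x ∈ convexHull ℝ V | l x = b} = convexHull ℝ {v ∈ V | l v = b} := by
  apply Subset.antisymm
  · have hconv : Convex ℝ ({x | l x < b} ∪ convexHull ℝ {v ∈ V | l v = b}) := by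
      have hl : ∀ x ∈ convexHull ℝ {v ∈ V | l v = b}, l x = b := fun x hx =>
        convexHull_min (t := {x | l x = b}) (fun v hv => hv.2)
          (convex_hyperplane l.toLinearMap.isLinear b) hx
      rw [convex_iff_forall_pos]
      rintro x hx y hy s t hs ht hst
      have key : ∀ {p q}, p ≤ b → q ≤ b → p < b ∨ q < b → s * p + t * q < b := by
        intro p q hp hq h
        have hb : s * b + t * b = b := by rw [← add_mul, hst, one_mul]
        have h1 := mul_le_mul_of_nonneg_left hp hs.le
        have h2 := mul_le_mul_of_nonneg_left hq ht.le
        rcases h with h | h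
        · linarith [mul_lt_mul_of_pos_left h hs]
        · linarith [mul_lt_mul_of_pos_left h ht]
      have hadd : l (s • x + t • y) = s * l x + t * l y := by simp
      rcases hx with hx | hx <;> rcases hy with hy | hy
      · exact Or.inl (hadd.trans_lt (key (le_of_lt hx) (le_of_lt hy) (Or.inl hx)))
      · exact Or.inl (hadd.trans_lt (key (le_of_lt hx) (hl y hy).le (Or.inl hx)))
      · exact Or.inl (hadd.trans_lt (key (hl x hx).le (le_of_lt hy) (Or.inr hy)))
      · exact Or.inr (convex_convexHull ℝ _ hx hy hs.le ht.le hst)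
    have hsub : convexHull ℝ V ⊆ {x | l x < b} ∪ convexHull ℝ {v ∈ V | l v = b} := by
      refine convexHull_min (fun v hv => ?_) hconv
      rcases (hV v hv).lt_or_eq with h | h
      · exact Or.inl h
      · exact Or.inr (subset_convexHull ℝ _ ⟨hv, h⟩)
    rintro x ⟨hx, hxb⟩
    rcases hsub hx with h | h
    · exact absurd hxb (ne_of_lt h)
    · exact h
  · intro x hx
    exact ⟨convexHull_mono (fun v hv => hv.1) hx,
      convexHull_min (t := {x | l x = b}) (fun v hv => hv.2)
        (convex_hyperplane l.toLinearMap.isLinear b) hx⟩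

theorem le_of_mem_convexHull {V : Set E} (l : StrongDual ℝ E) {b : ℝ} (hV : ∀ v ∈ V, l v ≤ b)
    {x : E} (hx : x ∈ convexHull ℝ V) : l x ≤ b :=
  convexHull_min (t := {x | l x ≤ b}) hV (convex_halfSpace_le l.toLinearMap.isLinear b) hx

theorem DefinesFace.isFace {P G : Set E} {l : StrongDual ℝ E} {b : ℝ} (h : DefinesFace P G l b) :
    IsFace P G := by
  rintro ⟨x₀, hx₀⟩
  rw [h.2] at hx₀
  refine ⟨l, ?_⟩
  rw [h.2]
  ext x
  constructor
  · rintro ⟨hx, hxb⟩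
    exact ⟨hx, fun y hy => hxb ▸ h.1 y hy⟩
  · rintro ⟨hx, hmax⟩
    exact ⟨hx, le_antisymm (h.1 x hx) (hx₀.2 ▸ hmax x₀ hx₀.1)⟩

theorem IsFace.exists_definesFace {P G : Set E} (h : IsFace P G) (hne : G.Nonempty) :
    ∃ l b, DefinesFace P G l b := by
  obtain ⟨l, hl⟩ := h hne
  obtain ⟨x₀, hx₀⟩ := hne
  have hx₀' := hx₀
  rw [hl] at hx₀'
  refine ⟨l, l x₀, hx₀'.2, ?_⟩
  rw [hl]
  ext x
  constructor
  · rintro ⟨hx, hmax⟩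
    exact ⟨hx, le_antisymm (hx₀'.2 x hx) (hmax x₀ hx₀'.1)⟩
  · rintro ⟨hx, hxb⟩
    exact ⟨hx, fun y hy => hxb ▸ hx₀'.2 y hy⟩

theorem IsPolytope.convex {P : Set E} (hP : IsPolytope P) : Convex ℝ P := by
  obtain ⟨V, rfl⟩ := hP
  exact convex_convexHull ℝ _

theorem IsPolytope.isCompact {P : Set E} (hP : IsPolytope P) : IsCompact P := by
  obtain ⟨V, rfl⟩ := hP
  exact V.finite_toSet.isCompact_convexHull ℝ

theorem isPolytope_convexHull {V : Set E} (hV : V.Finite) : IsPolytope (convexHull ℝ V) :=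
  ⟨hV.toFinset, by simp⟩

theorem IsFace.isPolytope {P G : Set E} (hP : IsPolytope P) (hG : IsFace P G) : IsPolytope G := by
  rcases G.eq_empty_or_nonempty with rfl | hne
  · exact ⟨∅, by simp⟩
  obtain ⟨V, rfl⟩ := hP
  obtain ⟨l, b, hl, rfl⟩ := hG.exists_definesFace hne
  rw [setOf_mem_convexHull_eq l (fun v hv => hl v (subset_convexHull ℝ _ hv))]
  exact isPolytope_convexHull (V.finite_toSet.subset fun v hv => hv.1)

/-- A face of a face of a polytope is a face of the polytope: if `l` defines `G` in `P` and `h`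
defines `H` in `G`, then `N • l + h` defines `H` in `P` for all large `N`. Finiteness of the
generating set is essential here. -/
theorem IsFace.trans {P G H : Set E} (hP : IsPolytope P) (hG : IsFace P G) (hH : IsFace G H) :
    IsFace P H := by
  rcases H.eq_empty_or_nonempty with rfl | hne
  · exact isExposed_empty
  obtain ⟨V, rfl⟩ := hP
  obtain ⟨l, b, hl, hGl⟩ := hG.exists_definesFace (hne.mono hH.subset)
  obtain ⟨h, c, hh, hHh⟩ := hH.exists_definesFace hne
  have hlV : ∀ v ∈ (V : Set E), l v ≤ b := fun v hv => hl v (subset_convexHull ℝ _ hv)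
  have hev : ∀ᶠ N : ℝ in Filter.atTop, ∀ v ∈ V, l v < b → N * l v + h v < N * b + c := by
    rw [Filter.eventually_all_finset]
    intro v _
    by_cases hv : l v < b
    · filter_upwards [Filter.eventually_gt_atTop ((h v - c) / (b - l v))] with N hN _
      rw [div_lt_iff₀ (by linarith)] at hN
      linarith
    · exact Filter.Eventually.of_forall fun N h => absurd h hv
  obtain ⟨N, hN⟩ := hev.exists
  have key : ∀ v ∈ (V : Set E), (N • l + h) v ≤ N * b + c ∧
      ((N • l + h) v = N * b + c ↔ (l v = b ∧ h v = c)) := by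
    intro v hv
    have e : (N • l + h) v = N * l v + h v := by simp
    rw [e]
    rcases (hlV v hv).lt_or_eq with h1 | h1
    · have := hN v hv h1
      exact ⟨this.le, fun h2 => absurd h2 this.ne, fun h2 => absurd h2.1 h1.ne⟩
    · have hvG : v ∈ G := by
        rw [hGl]; exact ⟨subset_convexHull ℝ _ hv, h1⟩
      have := hh v hvG
      rw [h1]
      exact ⟨by linarith, fun h2 => ⟨rfl, by linarith⟩, fun h2 => by rw [h2.2]⟩
  refine DefinesFace.isFace (l := N • l + h) (b := N * b + c)
    ⟨fun x hx => le_of_mem_convexHull _ (fun v hv => (key v hv).1) hx, ?_⟩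
  rw [setOf_mem_convexHull_eq _ (fun v hv => (key v hv).1), hHh, hGl,
    setOf_mem_convexHull_eq l hlV, setOf_mem_convexHull_eq h]
  · congr 1
    ext v
    constructor
    · rintro ⟨⟨hv, h1⟩, h2⟩
      exact ⟨hv, (key v hv).2.2 ⟨h1, h2⟩⟩
    · rintro ⟨hv, h1⟩
      exact ⟨⟨hv, ((key v hv).2.1 h1).1⟩, ((key v hv).2.1 h1).2⟩
  · rintro v ⟨hv, h1⟩
    exact hh v (by rw [hGl]; exact ⟨subset_convexHull ℝ _ hv, h1⟩)

/-! ### Dimension of faces -/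

theorem polyDim_empty : polyDim (∅ : Set E) = -1 := by simp [polyDim]

theorem polyDim_of_nonempty {S : Set E} (h : S.Nonempty) :
    polyDim S = Module.finrank ℝ (vectorSpan ℝ S) := by
  simp [polyDim, h.ne_empty]

theorem polyDim_nonneg_iff {S : Set E} : 0 ≤ polyDim S ↔ S.Nonempty := by
  rcases S.eq_empty_or_nonempty with rfl | h
  · simp [polyDim_empty]
  · simp [polyDim_of_nonempty h, h]

theorem polyDim_singleton (x : E) : polyDim ({x} : Set E) = 0 := by
  rw [polyDim_of_nonempty (singleton_nonempty x)]
  simp [vectorSpan_singleton]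

theorem DefinesFace.apply_eq_zero {P G : Set E} {l : StrongDual ℝ E} {b : ℝ}
    (h : DefinesFace P G l b) {u : E} (hu : u ∈ vectorSpan ℝ G) : l u = 0 := by
  have : vectorSpan ℝ G ≤ LinearMap.ker l.toLinearMap := by
    rw [vectorSpan_def, Submodule.span_le]
    rintro _ ⟨x, hx, y, hy, rfl⟩
    rw [h.2] at hx hy
    simp [hx.2, hy.2]
  exact this hu

variable [FiniteDimensional ℝ E]

theorem exists_eq_singleton_of_polyDim_eq_zero {S : Set E} (h : polyDim S = 0) : ∃ x, S = {x} := by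
  have hne : S.Nonempty := polyDim_nonneg_iff.1 h.ge
  rw [polyDim_of_nonempty hne] at h
  have h0 : vectorSpan ℝ S = ⊥ := Submodule.finrank_eq_zero.1 (by exact_mod_cast h)
  exact (exists_eq_singleton_iff_nonempty_subsingleton).2
    ⟨hne, (vectorSpan_eq_bot_iff_subsingleton ℝ).1 h0⟩

theorem polyDim_mono {S T : Set E} (h : S ⊆ T) : polyDim S ≤ polyDim T := by
  rcases S.eq_empty_or_nonempty with rfl | hS
  · rw [polyDim_empty]
    rcases T.eq_empty_or_nonempty with rfl | hT
    · rw [polyDim_empty]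
    · exact (by norm_num : (-1 : ℤ) ≤ 0).trans (polyDim_nonneg_iff.2 hT)
  · rw [polyDim_of_nonempty hS, polyDim_of_nonempty (hS.mono h)]
    exact_mod_cast Submodule.finrank_mono (vectorSpan_mono ℝ h)

theorem IsFace.polyDim_lt {P G : Set E} (hG : IsFace P G) (hne : G ≠ P) :
    polyDim G < polyDim P := by
  rcases G.eq_empty_or_nonempty with rfl | hGne
  · rw [polyDim_empty]
    exact lt_of_lt_of_le (by norm_num) (polyDim_nonneg_iff.2 (nonempty_iff_ne_empty.2 hne.symm))
  obtain ⟨l, b, hl⟩ := hG.exists_definesFace hGne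
  rw [polyDim_of_nonempty hGne, polyDim_of_nonempty (hGne.mono hG.subset)]
  norm_cast
  apply Submodule.finrank_lt_finrank_of_lt
  refine lt_of_le_of_ne (vectorSpan_mono ℝ hG.subset) fun heq => hne ?_
  refine hG.subset.antisymm fun y hy => ?_
  obtain ⟨x, hx⟩ := hGne
  have h1 : y - x ∈ vectorSpan ℝ G := heq ▸ vsub_mem_vectorSpan ℝ hy (hG.subset hx)
  have h2 := hl.apply_eq_zero h1
  rw [hl.2] at hx ⊢
  refine ⟨hy, ?_⟩
  rw [map_sub, hx.2] at h2
  linarith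

end Faces

/-! ### Polytopes are cut out by their facets -/

/-- Let `v` be a finite family that spans `D` and sums to zero. If `x` lies outside the convex
hull of `v`, as witnessed by `l₀ ≤ 1` on `v` and `1 < l₀ x`, then the witness can be chosen with
`{v i | l (v i) = 1}` spanning `D`. (In polar terms: a linear functional on the polar polytope is
maximized at a vertex.) -/
theorem exists_span_eq_top_of_forall_le_one {D ι : Type*} [AddCommGroup D] [Module ℝ D]
    [Fintype ι] (v : ι → D) (hspan : Submodule.span ℝ (range v) = ⊤) (hsum : ∑ i, v i = 0)
    {x : D} (l₀ : D →ₗ[ℝ] ℝ) (hl₀ : ∀ i, l₀ (v i) ≤ 1) (hx₀ : 1 < l₀ x) :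
    ∃ l : D →ₗ[ℝ] ℝ, (∀ i, l (v i) ≤ 1) ∧ 1 < l x ∧
      Submodule.span ℝ (v '' {i | l (v i) = 1}) = ⊤ := by
  classical
  let act : (D →ₗ[ℝ] ℝ) → Finset ι := fun l => Finset.univ.filter fun i => l (v i) = 1
  -- Among all witnesses, take one with the largest number of active constraints.
  obtain ⟨_, ⟨l, ⟨hl, hx⟩, rfl⟩, hmax⟩ := Set.exists_max_image
    (act '' {l | (∀ i, l (v i) ≤ 1) ∧ 1 < l x}) Finset.card (Set.toFinite _)
    ⟨_, l₀, ⟨hl₀, hx₀⟩, rfl⟩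
  refine ⟨l, hl, hx, ?_⟩
  by_contra hne
  obtain ⟨η, hη0, hηker⟩ := Submodule.exists_le_ker_of_lt_top _ (lt_top_iff_ne_top.2 hne)
  obtain ⟨η, hη0, hηker, hηx⟩ : ∃ η : D →ₗ[ℝ] ℝ, η ≠ 0 ∧
      Submodule.span ℝ (v '' {i | l (v i) = 1}) ≤ LinearMap.ker η ∧ 0 ≤ η x := by
    rcases le_total 0 (η x) with h | h
    · exact ⟨η, hη0, hηker, h⟩
    · refine ⟨-η, neg_ne_zero.2 hη0, fun y hy => ?_, by simpa using h⟩
      have := hηker hy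
      simp only [LinearMap.mem_ker] at this
      simp [this]
  have hηact : ∀ i, l (v i) = 1 → η (v i) = 0 := fun i hi =>
    hηker (Submodule.subset_span ⟨i, hi, rfl⟩)
  have hpos : ∃ i, 0 < η (v i) := by
    by_contra! hneg
    have hz : ∀ i ∈ Finset.univ, η (v i) = 0 := by
      refine (Finset.sum_eq_zero_iff_of_nonpos fun i _ => hneg i).1 ?_
      rw [← map_sum, hsum, map_zero]
    refine hη0 (LinearMap.ext_on_range hspan fun i => ?_)
    simpa using hz i (Finset.mem_univ i)
  -- Move along `η` until the next constraint becomes active.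
  obtain ⟨j, hj, hjmin⟩ := Set.exists_min_image {i | 0 < η (v i)}
    (fun i => (1 - l (v i)) / η (v i)) (Set.toFinite _) hpos
  have hj' : 0 < η (v j) := hj
  set t := (1 - l (v j)) / η (v j) with ht
  have ht0 : 0 ≤ t := div_nonneg (by linarith [hl j]) hj'.le
  have hl' : ∀ i, (l + t • η) (v i) ≤ 1 := by
    intro i
    simp only [LinearMap.add_apply, LinearMap.smul_apply, smul_eq_mul]
    rcases le_or_gt (η (v i)) 0 with h | h
    · linarith [hl i, mul_nonpos_of_nonneg_of_nonpos ht0 h]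
    · have := hjmin i h
      rw [le_div_iff₀ h] at this
      linarith
  have hlt : (act l).card < (act (l + t • η)).card := by
    apply Finset.card_lt_card
    rw [Finset.ssubset_iff_of_subset]
    · refine ⟨j, ?_, ?_⟩
      · simp only [act, Finset.mem_filter, Finset.mem_univ, true_and, LinearMap.add_apply,
          LinearMap.smul_apply, smul_eq_mul, ht]
        field_simp
        ring
      · simp only [act, Finset.mem_filter, Finset.mem_univ, true_and]
        exact fun h => hj'.ne' (hηact j h)
    · intro i hi
      simp only [act, Finset.mem_filter, Finset.mem_univ, true_and, LinearMap.add_apply,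
          LinearMap.smul_apply, smul_eq_mul] at hi ⊢
      rw [hi, hηact i hi]; ring
  refine absurd (hmax _ ⟨l + t • η, ⟨hl', ?_⟩, rfl⟩) (not_le.2 hlt)
  simp only [LinearMap.add_apply, LinearMap.smul_apply, smul_eq_mul]
  linarith [mul_nonneg ht0 hηx]

section Facets

variable {E W : Type*} [NormedAddCommGroup E] [NormedSpace ℝ E]
  [NormedAddCommGroup W] [NormedSpace ℝ W] [FiniteDimensional ℝ E]

/-- A point of the affine span of a polytope that is not in the polytope violates the inequality
of some facet. -/
theorem IsPolytope.exists_isFacet_lt {P : Set E} (hP : IsPolytope P) {x : E}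
    (hx : x ∈ affineSpan ℝ P) (hxP : x ∉ P) :
    ∃ G l b, IsFacet P G ∧ G.Nonempty ∧ DefinesFace P G l b ∧ b < l x := by
  classical
  have hPne : P.Nonempty := (affineSpan_nonempty ℝ).1 ⟨x, hx⟩
  have hcl : IsClosed P := hP.isCompact.isClosed
  have hcv := hP.convex
  obtain ⟨V, rfl⟩ := hP
  have hVne : V.Nonempty := by simpa using hPne
  set P := convexHull ℝ (V : Set E) with hPdef
  have hVP : ∀ v : V, (v : E) ∈ P := fun v => subset_convexHull ℝ _ v.2
  -- The centroid of the generators serves as the origin.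
  set x₀ : E := ∑ v : V, (Fintype.card V : ℝ)⁻¹ • (v : E) with hx₀
  have : Nonempty V := hVne.to_subtype
  have hcard : (Fintype.card V : ℝ) ≠ 0 := by exact_mod_cast Fintype.card_ne_zero
  have hx₀P : x₀ ∈ P := by
    refine hcv.sum_mem (fun _ _ => by positivity) ?_ (fun v _ => hVP v)
    rw [Finset.sum_const, Finset.card_univ, nsmul_eq_mul, mul_inv_cancel₀ hcard]
  let D := vectorSpan ℝ P
  have hmem : ∀ {y}, y ∈ P → y - x₀ ∈ D := fun hy => vsub_mem_vectorSpan ℝ hy hx₀P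
  let v : V → D := fun i => ⟨(i : E) - x₀, hmem (hVP i)⟩
  have hsum : ∑ i, v i = 0 := by
    apply Subtype.ext
    simp only [v, AddSubmonoidClass.coe_finsetSum, Finset.sum_sub_distrib, Finset.sum_const,
      Finset.card_univ, Submodule.coe_zero]
    rw [hx₀, ← Finset.smul_sum, ← Nat.cast_smul_eq_nsmul ℝ, smul_smul, mul_inv_cancel₀ hcard,
      one_smul, sub_self]
  have hspan : Submodule.span ℝ (range v) = ⊤ := by
    have hD : D = vectorSpan ℝ (insert x₀ (V : Set E)) := by
      apply le_antisymm
      · have h1 : D = vectorSpan ℝ (V : Set E) := by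
          change vectorSpan ℝ P = _
          rw [← direction_affineSpan, ← direction_affineSpan, hPdef, affineSpan_convexHull]
        rw [h1]
        exact vectorSpan_mono ℝ (subset_insert _ _)
      · exact vectorSpan_mono ℝ (insert_subset hx₀P fun y hy => hVP ⟨y, hy⟩)
    rw [← Submodule.map_injective_of_injective D.injective_subtype |>.eq_iff, Submodule.map_span,
      Submodule.map_top, Submodule.range_subtype]
    refine Eq.trans ?_ hD.symm
    rw [vectorSpan_eq_span_vsub_set_right ℝ (mem_insert _ _), image_insert_eq, vsub_self,
      Submodule.span_insert_zero]
    congr 1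
    ext y
    simp only [v, Submodule.coe_subtype, mem_image, mem_range, vsub_eq_sub]
    constructor
    · rintro ⟨_, ⟨i, rfl⟩, rfl⟩
      exact ⟨i, i.2, rfl⟩
    · rintro ⟨w, hw, rfl⟩
      exact ⟨_, ⟨⟨w, hw⟩, rfl⟩, rfl⟩
  obtain ⟨f, u, hfu, hux⟩ := geometric_hahn_banach_closed_point hcv hcl hxP
  have hu0 : 0 < u - f x₀ := by linarith [hfu x₀ hx₀P]
  have hxD : x - x₀ ∈ D := by
    have := AffineSubspace.vsub_mem_direction hx (subset_affineSpan ℝ P hx₀P)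
    rwa [direction_affineSpan] at this
  obtain ⟨l, hl, hlx, hltop⟩ := exists_span_eq_top_of_forall_le_one v hspan hsum
    (x := ⟨x - x₀, hxD⟩) ((u - f x₀)⁻¹ • (f.toLinearMap.domRestrict D)) (by
      intro i
      simp only [v, LinearMap.smul_apply, LinearMap.domRestrict_apply, smul_eq_mul]
      rw [inv_mul_le_iff₀ hu0]
      simp only [ContinuousLinearMap.coe_coe, map_sub]
      linarith [hfu i (hVP i)]) (by
      simp only [LinearMap.smul_apply, LinearMap.domRestrict_apply, smul_eq_mul]
      rw [lt_inv_mul_iff₀ hu0]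
      simp only [ContinuousLinearMap.coe_coe, map_sub]
      linarith)
  obtain ⟨l', hl'⟩ := LinearMap.exists_extend l
  let L : StrongDual ℝ E := LinearMap.toContinuousLinearMap l'
  have hL : ∀ y (hy : y - x₀ ∈ D), L y = L x₀ + l ⟨y - x₀, hy⟩ := by
    intro y hy
    rw [← hl']
    simp [L]
  have hLV : ∀ w ∈ (V : Set E), L w ≤ L x₀ + 1 := by
    intro w hw
    rw [hL w (hmem (hVP ⟨w, hw⟩))]
    linarith [hl ⟨w, hw⟩]
  have hdef : DefinesFace P {y ∈ P | L y = L x₀ + 1} L (L x₀ + 1) :=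
    ⟨fun y hy => le_of_mem_convexHull L hLV hy, rfl⟩
  have hact : ∀ i : V, l (v i) = 1 → (i : E) ∈ {y ∈ P | L y = L x₀ + 1} := by
    intro i hi
    refine ⟨hVP i, ?_⟩
    rw [hL i (hmem (hVP i)), ← hi]
  have hne : ∃ i, l (v i) = 1 := by
    by_contra! h
    have h0 : {i | l (v i) = 1} = ∅ := by ext i; simpa using h i
    rw [h0, image_empty, Submodule.span_empty] at hltop
    have : (⟨x - x₀, hxD⟩ : D) ∈ (⊥ : Submodule ℝ D) := hltop ▸ Submodule.mem_top
    rw [Submodule.mem_bot] at this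
    rw [this, map_zero] at hlx
    linarith
  obtain ⟨i₀, hi₀⟩ := hne
  refine ⟨_, L, L x₀ + 1, ⟨hdef.isFace, ?_⟩, ⟨_, hact i₀ hi₀⟩, hdef, ?_⟩
  · apply le_antisymm
    · have : ({y ∈ P | L y = L x₀ + 1} : Set E) ≠ P := fun h => by
        have := hx₀P
        rw [← h] at this
        linarith [this.2]
      have := hdef.isFace.polyDim_lt this
      omega
    · rw [polyDim_of_nonempty ⟨_, hact i₀ hi₀⟩, polyDim_of_nonempty hPne]
      -- The active generators, seen from `x₀`, span `D`, and they differ from one of them by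
      -- vectors parallel to the face.
      have hle : D ≤ vectorSpan ℝ {y ∈ P | L y = L x₀ + 1} ⊔ Submodule.span ℝ {(i₀ : E) - x₀} := by
        have h1 := congrArg (Submodule.map D.subtype) hltop
        rw [Submodule.map_span, Submodule.map_top, Submodule.range_subtype] at h1
        rw [← h1, Submodule.span_le]
        rintro _ ⟨_, ⟨i, hi, rfl⟩, rfl⟩
        have h2 : D.subtype (v i) = ((i : E) - i₀) + ((i₀ : E) - x₀) := by simp [v]
        rw [h2]
        exact Submodule.add_mem_sup (vsub_mem_vectorSpan ℝ (hact i hi) (hact i₀ hi₀))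
          (Submodule.mem_span_singleton_self _)
      have h3 := (Submodule.finrank_mono hle).trans (Submodule.finrank_add_le_finrank_add_finrank _ _)
      have h4 : Module.finrank ℝ (Submodule.span ℝ {(i₀ : E) - x₀}) ≤ 1 := by
        simpa using finrank_span_le_card (R := ℝ) ({(i₀ : E) - x₀} : Set E)
      change (Module.finrank ℝ D : ℤ) - 1 ≤ _
      omega
  · rw [hL x hxD]
    linarith

/-- All inequalities that define a given facet are violated by the same points of the affine
span. -/
theorem IsFacet.lt_apply {P G : Set E} (hG : IsFacet P G) (hne : G.Nonempty)
    {l l' : StrongDual ℝ E} {b b' : ℝ} (h : DefinesFace P G l b) (h' : DefinesFace P G l' b')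
    {x : E} (hx : x ∈ affineSpan ℝ P) (hxb : b < l x) : b' < l' x := by
  have hGP : G ≠ P := fun h => by have := hG.2; rw [h] at this; omega
  obtain ⟨y, hyP, hyG⟩ := exists_of_ssubset (hG.1.subset.ssubset_of_ne hGP)
  obtain ⟨z, hz⟩ := hne
  have hzP := hG.1.subset hz
  have hzl : l z = b := by rw [h.2] at hz; exact hz.2
  have hzl' : l' z = b' := by rw [h'.2] at hz; exact hz.2
  have hyl : l y < b := lt_of_le_of_ne (h.1 y hyP) fun e => hyG (by rw [h.2]; exact ⟨hyP, e⟩)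
  have hyl' : l' y < b' := lt_of_le_of_ne (h'.1 y hyP) fun e => hyG (by rw [h'.2]; exact ⟨hyP, e⟩)
  have hn : y - z ∈ vectorSpan ℝ P := vsub_mem_vectorSpan ℝ hyP hzP
  -- Comparing dimensions, the kernel of `l` on the direction of `P` is the direction of `G`.
  have hker : vectorSpan ℝ P ⊓ LinearMap.ker l.toLinearMap ≤ vectorSpan ℝ G := by
    have hle : vectorSpan ℝ G ≤ vectorSpan ℝ P ⊓ LinearMap.ker l.toLinearMap :=
      le_inf (vectorSpan_mono ℝ hG.1.subset) fun w hw => h.apply_eq_zero hw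
    refine (Submodule.eq_of_le_of_finrank_le hle ?_).ge
    have hlt : vectorSpan ℝ P ⊓ LinearMap.ker l.toLinearMap < vectorSpan ℝ P := by
      refine lt_of_le_of_ne inf_le_left fun e => ?_
      rw [← e] at hn
      have h0 : l (y - z) = 0 := hn.2
      rw [map_sub] at h0
      linarith
    have h1 := Submodule.finrank_lt_finrank_of_lt hlt
    have h2 := hG.2
    rw [polyDim_of_nonempty ⟨z, hz⟩, polyDim_of_nonempty ⟨z, hzP⟩] at h2
    omega
  have hxz : x - z ∈ vectorSpan ℝ P := by
    have := AffineSubspace.vsub_mem_direction hx (subset_affineSpan ℝ P hzP)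
    rwa [direction_affineSpan] at this
  have hd : l (y - z) < 0 := by rw [map_sub]; linarith
  have hd' : l' (y - z) < 0 := by rw [map_sub]; linarith
  set t := l (x - z) / l (y - z) with ht
  have ht0 : t < 0 := div_neg_of_pos_of_neg (by rw [map_sub]; linarith) hd
  have hw : (x - z) - t • (y - z) ∈ vectorSpan ℝ P ⊓ LinearMap.ker l.toLinearMap := by
    refine ⟨Submodule.sub_mem _ hxz (Submodule.smul_mem _ _ hn), ?_⟩
    change l _ = 0
    rw [map_sub, map_smul, smul_eq_mul, ht, div_mul_cancel₀ _ hd.ne, sub_self]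
  have h0 := h'.apply_eq_zero (hker hw)
  rw [map_sub, map_smul, smul_eq_mul, map_sub l' x z] at h0
  have := mul_pos_of_neg_of_neg ht0 hd'
  linarith

/-- A polytope is cut out of its affine span by the inequalities of its facets. -/
theorem IsPolytope.mem_of_forall_le {m : ℕ} {P : Set E} (hP : IsPolytope P) {F : Fin m → Set E}
    (hF : IsFacetEnumeration P F) {l : Fin m → StrongDual ℝ E} {b : Fin m → ℝ}
    (hl : ∀ i, DefinesFace P (F i) (l i) (b i)) {x : E} (hx : x ∈ affineSpan ℝ P)
    (hxl : ∀ i, l i x ≤ b i) : x ∈ P := by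
  by_contra hxP
  obtain ⟨G, l', b', hG, hGne, hdef, hlt⟩ := hP.exists_isFacet_lt hx hxP
  obtain ⟨i, rfl⟩ : G ∈ range F := by rw [hF.2]; exact hG
  exact absurd (hG.lt_apply hGne hdef (hl i) hx hlt) (not_lt.2 (hxl i))

/-! ### Vertices, and the dimension as a combinatorial invariant -/

theorem IsPolytope.exists_isFacet {P : Set E} (hP : IsPolytope P) (hdim : 0 < polyDim P) :
    ∃ G, IsFacet P G ∧ G.Nonempty := by
  have hne : P.Nonempty := polyDim_nonneg_iff.1 hdim.le
  rw [polyDim_of_nonempty hne] at hdim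
  have hnt : (affineSpan ℝ P : Set E) ≠ P := by
    intro h
    obtain ⟨p, hp⟩ := hne
    obtain ⟨u, hu, hu0⟩ := (Submodule.ne_bot_iff (vectorSpan ℝ P)).1 fun h0 => by
      rw [h0, finrank_bot] at hdim; exact lt_irrefl _ hdim
    -- A polytope of positive dimension does not contain a line.
    obtain ⟨C, hC⟩ := hP.isCompact.isBounded.exists_norm_le
    have hline : ∀ t : ℝ, p + t • u ∈ P := fun t => by
      rw [← h]
      have h1 : t • u ∈ (affineSpan ℝ P).direction := by
        rw [direction_affineSpan]; exact Submodule.smul_mem _ _ hu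
      have := AffineSubspace.vadd_mem_of_mem_direction h1 (subset_affineSpan ℝ P hp)
      rwa [vadd_eq_add, add_comm] at this
    have hupos : 0 < ‖u‖ := norm_pos_iff.2 hu0
    have hC0 : 0 ≤ C := (norm_nonneg _).trans (hC p hp)
    have h1 := hC _ (hline ((2 * C + 1) / ‖u‖))
    have h2 : ‖((2 * C + 1) / ‖u‖) • u‖ = 2 * C + 1 := by
      rw [norm_smul, Real.norm_of_nonneg (by positivity), div_mul_cancel₀ _ hupos.ne']
    have h3 := norm_sub_le (p + ((2 * C + 1) / ‖u‖) • u) p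
    rw [add_sub_cancel_left, h2] at h3
    linarith [hC p hp]
  obtain ⟨x, hx, hxP⟩ := exists_of_ssubset ((subset_affineSpan ℝ P).ssubset_of_ne hnt.symm)
  obtain ⟨G, _, _, hG, hGne, _⟩ := hP.exists_isFacet_lt hx hxP
  exact ⟨G, hG, hGne⟩

theorem IsPolytope.exists_isVertex {P : Set E} (hP : IsPolytope P) (hne : P.Nonempty) :
    ∃ x, IsVertex P {x} := by
  obtain ⟨n, hn⟩ : ∃ n : ℕ, polyDim P = n := ⟨_, polyDim_of_nonempty hne⟩
  induction n generalizing P with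
  | zero =>
    obtain ⟨x, rfl⟩ := exists_eq_singleton_of_polyDim_eq_zero (by simpa using hn)
    exact ⟨x, IsExposed.refl _, polyDim_singleton x⟩
  | succ n ih =>
    obtain ⟨G, hG, hGne⟩ := hP.exists_isFacet (by rw [hn]; positivity)
    obtain ⟨x, hx⟩ := ih (hG.1.isPolytope hP) hGne (by rw [hG.2, hn]; push_cast; ring)
    exact ⟨x, hG.1.trans hP hx.1, hx.2⟩

/-- A strictly monotone map from the face lattice of a polytope `P` to that of `Q` can exist only
if `dim P ≤ dim Q`: descend from `P` through facets, and use that dimensions of faces of `Q`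
increase strictly. -/
theorem IsPolytope.polyDim_le_of_strictMono [FiniteDimensional ℝ W] {P : Set E}
    (hP : IsPolytope P) (hne : P.Nonempty) {Q : Set W} (φ : FaceLattice P → FaceLattice Q)
    (hφ : StrictMono φ) : polyDim P ≤ polyDim (φ ⟨P, IsExposed.refl P⟩ : Set W) := by
  have hlt : ∀ {G H : FaceLattice P}, G < H → polyDim (φ G : Set W) < polyDim (φ H : Set W) := by
    intro G H hGH
    have h := hφ hGH
    exact IsFace.polyDim_lt ((φ G).2.mono (φ H).2.subset h.le)
      fun e => h.ne (Subtype.ext e)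
  obtain ⟨n, hn⟩ : ∃ n : ℕ, polyDim P = n := ⟨_, polyDim_of_nonempty hne⟩
  induction n generalizing P with
  | zero =>
    have h : (⟨∅, isExposed_empty⟩ : FaceLattice P) < ⟨P, IsExposed.refl P⟩ :=
      Subtype.mk_lt_mk.2 (by simpa [empty_ssubset] using hne)
    have h1 := hlt h
    have h2 : -1 ≤ polyDim (φ ⟨∅, isExposed_empty⟩ : Set W) := by
      rw [← polyDim_empty (E := W)]
      exact polyDim_mono (empty_subset _)
    rw [hn]
    push_cast
    omega
  | succ n ih =>
    obtain ⟨G, hG, hGne⟩ := hP.exists_isFacet (by rw [hn]; positivity)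
    have hGP : G ≠ P := fun h => by have := hG.2; rw [h] at this; omega
    let ι : FaceLattice G → FaceLattice P := fun H => ⟨H, hG.1.trans hP H.2⟩
    have hι : StrictMono ι := fun H K h => h
    have h1 := ih (hG.1.isPolytope hP) hGne (φ ∘ ι) (hφ.comp hι) (fun h => hlt (hι h))
      (by rw [hG.2, hn]; push_cast; ring)
    have h2 : ι ⟨G, IsExposed.refl G⟩ < ⟨P, IsExposed.refl P⟩ :=
      Subtype.mk_lt_mk.2 (hG.1.subset.ssubset_of_ne hGP)
    have h3 := hlt h2
    have h4 := hG.2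
    simp only [Function.comp] at h1
    omega

/-- Combinatorially isomorphic polytopes have equal dimensions; only this inequality is needed. -/
theorem CombIso.polyDim_le [FiniteDimensional ℝ W] {P : Set E} {Q : Set W} (h : CombIso P Q)
    (hP : IsPolytope P) (hne : P.Nonempty) : polyDim P ≤ polyDim Q := by
  obtain ⟨φ⟩ := h
  exact (hP.polyDim_le_of_strictMono hne φ φ.strictMono).trans (polyDim_mono (φ _).2.subset)

/-- Every proper nonempty face of a polytope misses some vertex: take a vertex of the opposite
face, where a functional defining the given face is minimal. -/
theorem IsProperFace.exists_isVertex_notMem {P G : Set E} (hP : IsPolytope P) (hG : IsProperFace P G)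
    (hne : G.Nonempty) : ∃ x, IsVertex P {x} ∧ x ∉ G := by
  obtain ⟨l, b, hl⟩ := hG.1.exists_definesFace hne
  obtain ⟨y, hy, hmin⟩ := hP.isCompact.exists_isMinOn (hne.mono hG.1.subset)
    l.continuous.continuousOn
  have hdef : DefinesFace P {x ∈ P | (-l) x = -l y} (-l) (-l y) :=
    ⟨fun x hx => neg_le_neg (hmin hx), rfl⟩
  obtain ⟨x, hx⟩ := (hdef.isFace.isPolytope hP).exists_isVertex ⟨y, hy, rfl⟩
  refine ⟨x, ⟨hdef.isFace.trans hP hx.1, hx.2⟩, fun hxG => hG.2 ?_⟩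
  have hxy : -l x = -l y := (hx.1.subset (mem_singleton x)).2
  rw [hl.2] at hxG
  refine hG.1.subset.antisymm fun z hz => ?_
  rw [hl.2]
  have h1 : l y ≤ l z := hmin hz
  exact ⟨hz, le_antisymm (hl.1 z hz) (by linarith [hxG.2])⟩

end Facets

/-! ### Strictly preserved faces -/

/-- Rank–nullity for the restriction of a linear map to a subspace. -/
theorem finrank_map_add_finrank_inf_ker {U V : Type*} [AddCommGroup U] [Module ℝ U]
    [FiniteDimensional ℝ U] [AddCommGroup V] [Module ℝ V] (f : U →ₗ[ℝ] V) (p : Submodule ℝ U) :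
    Module.finrank ℝ (p.map f) + Module.finrank ℝ ↥(p ⊓ LinearMap.ker f) = Module.finrank ℝ p := by
  have h := (f.domRestrict p).finrank_range_add_finrank_ker
  rw [LinearMap.range_domRestrict] at h
  rw [← h]
  congr 1
  have hmap : (LinearMap.ker (f.domRestrict p)).map p.subtype = p ⊓ LinearMap.ker f := by
    ext u
    simp [and_comm]
  rw [← hmap]
  exact ((Submodule.equivMapOfInjective _ p.injective_subtype _).finrank_eq).symm

section StrictlyPreserved

variable {E W : Type*} [NormedAddCommGroup E] [NormedSpace ℝ E]
  [NormedAddCommGroup W] [NormedSpace ℝ W]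

/-- Finitely many valid inequalities, each strict somewhere on a convex set, are simultaneously
strict somewhere. -/
theorem exists_mem_forall_lt {ι : Type*} {G : Set E} (hG : Convex ℝ G) (hne : G.Nonempty)
    {l : ι → StrongDual ℝ E} {b : ι → ℝ} (hle : ∀ i, ∀ x ∈ G, l i x ≤ b i) (s : Finset ι)
    (hs : ∀ i ∈ s, ∃ x ∈ G, l i x < b i) : ∃ x ∈ G, ∀ i ∈ s, l i x < b i := by
  classical
  induction s using Finset.induction_on with
  | empty => exact ⟨hne.some, hne.some_mem, by simp⟩
  | insert j s hj ih =>
    obtain ⟨x, hx, hxs⟩ := ih fun i hi => hs i (Finset.mem_insert_of_mem hi)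
    obtain ⟨y, hy, hyj⟩ := hs j (Finset.mem_insert_self j s)
    refine ⟨(1 / 2 : ℝ) • x + (1 / 2 : ℝ) • y,
      hG hx hy (by norm_num) (by norm_num) (by norm_num), fun i hi => ?_⟩
    simp only [map_add, map_smul, smul_eq_mul]
    rcases Finset.mem_insert.1 hi with rfl | hi
    · linarith [hle i x hx]
    · linarith [hle i y hy, hxs i hi]

variable {m : ℕ} {P : Set E} {F : Fin m → Set E}
  {l : Fin m → StrongDual ℝ E} {b : Fin m → ℝ}

/-- A nonempty face has a point that lies on no facets but those containing the whole face. -/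
theorem IsFace.exists_mem_forall_mem_facetIncidences {G : Set E} (hP : IsPolytope P)
    (hl : ∀ i, DefinesFace P (F i) (l i) (b i)) (hG : IsFace P G) (hne : G.Nonempty) :
    ∃ x ∈ G, ∀ i, l i x = b i → i ∈ facetIncidences F G := by
  classical
  obtain ⟨x, hx, hlt⟩ := exists_mem_forall_lt (hG.isPolytope hP).convex hne
    (fun i x hx => (hl i).1 x (hG.subset hx))
    (Finset.univ.filter fun i => i ∉ facetIncidences F G) fun i hi => by
      obtain ⟨y, hy, hyF⟩ := not_subset.1 (Finset.mem_filter.1 hi).2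
      refine ⟨y, hy, lt_of_le_of_ne ((hl i).1 y (hG.subset hy)) fun h => hyF ?_⟩
      rw [(hl i).2]
      exact ⟨hG.subset hy, h⟩
  refine ⟨x, hx, fun i hi => ?_⟩
  by_contra h
  exact (hlt i (Finset.mem_filter.2 ⟨Finset.mem_univ i, h⟩)).ne hi

variable [FiniteDimensional ℝ E]

/-- The cone of feasible directions of a polytope at a point is given by the facets through that
point. -/
theorem IsPolytope.exists_add_smul_mem (hP : IsPolytope P) (hF : IsFacetEnumeration P F)
    (hl : ∀ i, DefinesFace P (F i) (l i) (b i)) {x u : E} (hx : x ∈ P)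
    (hu : u ∈ vectorSpan ℝ P) (hxu : ∀ i, l i x = b i → l i u ≤ 0) :
    ∃ ε : ℝ, 0 < ε ∧ x + ε • u ∈ P := by
  have hev : ∀ᶠ ε : ℝ in 𝓝[>] 0, ∀ i, l i (x + ε • u) ≤ b i := by
    rw [Filter.eventually_all]
    intro i
    rcases ((hl i).1 x hx).lt_or_eq with h | h
    · have hc : Continuous fun ε : ℝ => l i (x + ε • u) := by fun_prop
      have : ∀ᶠ ε : ℝ in 𝓝 0, l i (x + ε • u) < b i :=
        hc.continuousAt.eventually_lt continuousAt_const (by simpa using h)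
      exact (this.filter_mono nhdsWithin_le_nhds).mono fun ε hε => hε.le
    · filter_upwards [self_mem_nhdsWithin] with ε hε
      rw [map_add, map_smul, h, smul_eq_mul]
      linarith [mul_nonpos_of_nonneg_of_nonpos (le_of_lt (mem_Ioi.1 hε)) (hxu i h)]
  obtain ⟨ε, hε, hε0⟩ := (hev.and self_mem_nhdsWithin).exists
  refine ⟨ε, hε0, hP.mem_of_forall_le hF hl ?_ hε⟩
  have h1 : ε • u ∈ (affineSpan ℝ P).direction := by
    rw [direction_affineSpan]
    exact Submodule.smul_mem _ _ hu
  have := AffineSubspace.vadd_mem_of_mem_direction h1 (subset_affineSpan ℝ P hx)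
  rwa [vadd_eq_add, add_comm] at this

theorem IsProperFace.facetIncidences_nonempty {G : Set E} (hP : IsPolytope P)
    (hF : IsFacetEnumeration P F) (hl : ∀ i, DefinesFace P (F i) (l i) (b i))
    (hG : IsProperFace P G) (hne : G.Nonempty) : (facetIncidences F G).Nonempty := by
  by_contra hI
  rw [not_nonempty_iff_eq_empty] at hI
  obtain ⟨x, hx, hxI⟩ := hG.1.exists_mem_forall_mem_facetIncidences hP hl hne
  obtain ⟨y, hyP, hyG⟩ := exists_of_ssubset (hG.1.subset.ssubset_of_ne hG.2)
  have hxP := hG.1.subset hx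
  -- One could move from `x` inside `P` away from any point `y` of `P` outside the face.
  obtain ⟨ε, hε, hmem⟩ := hP.exists_add_smul_mem hF hl hxP (u := x - y)
    (vsub_mem_vectorSpan ℝ hxP hyP) fun i hi => by
      have := hxI i hi
      rw [hI] at this
      exact this.elim
  obtain ⟨g, c, hg, hGg⟩ := hG.1.exists_definesFace hne
  have h1 := hg _ hmem
  rw [hGg] at hx hyG
  have h2 : g y < c := lt_of_le_of_ne (hg y hyP) fun h => hyG ⟨hyP, h⟩
  rw [map_add, map_smul, map_sub, hx.2, smul_eq_mul] at h1
  have := mul_pos hε (sub_pos.2 h2)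
  linarith

variable [FiniteDimensional ℝ W] {π : E →ᵃ[ℝ] W}

/-- Combinatorial equivalence of `G` and `π(G)` makes `π` injective on the affine span of `G`. -/
theorem StrictlyPreserved.eq_zero_of_mem_vectorSpan {G : Set E} (hP : IsPolytope P)
    (hG : StrictlyPreserved P π G) (hne : G.Nonempty) {u : E} (hu : u ∈ vectorSpan ℝ G)
    (hπ : π.linear u = 0) : u = 0 := by
  have hdim := hG.combIso.polyDim_le (hG.isProperFace.1.isPolytope hP) hne
  rw [polyDim_of_nonempty hne, polyDim_of_nonempty (hne.image π),
    ← AffineMap.map_vectorSpan] at hdim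
  have hrank := finrank_map_add_finrank_inf_ker π.linear (vectorSpan ℝ G)
  have hker : vectorSpan ℝ G ⊓ LinearMap.ker π.linear = ⊥ :=
    Submodule.finrank_eq_zero.1 (by omega)
  exact (Submodule.mem_bot ℝ).1 (hker ▸ ⟨hu, hπ⟩)

/-- The key property of a strictly preserved face: the normals of the facets containing it,
restricted to the fibre direction of the projection, positively span the dual space. Indeed, a
direction in the fibre that is feasible at a relatively interior point of the face stays in the
preimage of the image of the face, hence in the face, on which the projection is injective. -/
theorem StrictlyPreserved.eq_zero_of_forall_le {G : Set E} (hP : IsPolytope P)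
    (hF : IsFacetEnumeration P F) (hl : ∀ i, DefinesFace P (F i) (l i) (b i))
    (hG : StrictlyPreserved P π G) (hne : G.Nonempty) {u : E} (hu : u ∈ fibreDirection P π)
    (hle : ∀ i ∈ facetIncidences F G, l i u ≤ 0) : u = 0 := by
  have hface := hG.isProperFace.1
  obtain ⟨x, hx, hxI⟩ := hface.exists_mem_forall_mem_facetIncidences hP hl hne
  obtain ⟨ε, hε, hmem⟩ := hP.exists_add_smul_mem hF hl (hface.subset hx) hu.1
    fun i hi => hle i (hxI i hi)
  have hπu : π.linear u = 0 := hu.2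
  have hG' : x + ε • u ∈ G := by
    rw [← hG.preimage_eq]
    refine ⟨hmem, x, hx, ?_⟩
    have := π.map_vadd x (ε • u)
    rw [vadd_eq_add, vadd_eq_add, map_smul, hπu, smul_zero, zero_add, add_comm] at this
    exact this.symm
  have h1 : ε • u ∈ vectorSpan ℝ G := by
    have := vsub_mem_vectorSpan ℝ hG' hx
    rwa [vsub_eq_sub, add_sub_cancel_left] at this
  refine hG.eq_zero_of_mem_vectorSpan hP hne ?_ hπu
  rwa [Submodule.smul_mem_iff _ hε.ne'] at h1

omit [FiniteDimensional ℝ W] in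
theorem finrank_fibreDirection_add (P : Set E) (π : E →ᵃ[ℝ] W) :
    Module.finrank ℝ (vectorSpan ℝ (π '' P)) + Module.finrank ℝ (fibreDirection P π) =
      Module.finrank ℝ (vectorSpan ℝ P) := by
  rw [← AffineMap.map_vectorSpan]
  exact finrank_map_add_finrank_inf_ker _ _

end StrictlyPreserved

/-! ### Positively spanning families -/

section PositiveSpan

variable {ι L : Type*} [AddCommGroup L] [Module ℝ L] [FiniteDimensional ℝ L]
  {g : ι → L →ₗ[ℝ] ℝ}

/-- A form of Stiemke's lemma: if only `u = 0` satisfies `g i u ≤ 0` for all `i ∈ I`, then the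
`g i` with `i ∈ I` admit a linear dependency with strictly positive coefficients. Proof: separate
the subspace of all vectors `(g i u)ᵢ` from the standard simplex. -/
theorem exists_pos_dependency [Fintype ι] (I : Set ι) (h : ∀ u, (∀ i ∈ I, g i u ≤ 0) → u = 0) :
    ∃ c : ι → ℝ, (∀ i ∈ I, 0 < c i) ∧ (∀ i ∉ I, c i = 0) ∧ ∑ i, c i • g i = 0 := by
  classical
  let T : L →ₗ[ℝ] (I → ℝ) := LinearMap.pi fun i => g i
  have hdisj : Disjoint (LinearMap.range T : Set (I → ℝ)) (stdSimplex ℝ I) := by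
    rw [Set.disjoint_left]
    rintro _ ⟨u, rfl⟩ ⟨hnn, hsum⟩
    have hu : -u = 0 := h _ fun i hi => by
      have : 0 ≤ g i u := hnn ⟨i, hi⟩
      simpa using this
    rw [neg_eq_zero.1 hu, map_zero] at hsum
    simp at hsum
  obtain ⟨f, s, t, hs, hst, ht⟩ := geometric_hahn_banach_closed_compact
    (LinearMap.range T).convex (Submodule.closed_of_finiteDimensional _)
    (convex_stdSimplex ℝ I) (isCompact_stdSimplex ℝ I) hdisj
  -- A functional bounded above on a subspace vanishes there.
  have hs0 : 0 < s := by simpa using hs 0 (Submodule.zero_mem _)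
  have hf0 : ∀ u, f (T u) = 0 := by
    intro u
    by_contra hne
    have := hs (T (((s + 1) / f (T u)) • u)) ⟨_, rfl⟩
    rw [map_smul, map_smul, smul_eq_mul, div_mul_cancel₀ _ hne] at this
    linarith
  let p : ι → I → ℝ := fun i j => if (j : ι) = i then 1 else 0
  refine ⟨fun i => f (p i), fun i hi => ?_, fun i hi => ?_, ?_⟩
  · have hp : p i = Pi.single ⟨i, hi⟩ 1 := by
      funext j
      simp [p, Pi.single_apply, Subtype.ext_iff]
    simp only [hp]
    exact hs0.trans (hst.trans (ht _ (single_mem_stdSimplex ℝ _)))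
  · have hp : p i = 0 := by
      funext j
      exact if_neg fun (h : (j : ι) = i) => hi (h ▸ j.2)
    simp only [hp, map_zero]
  · ext u
    have hT : T u = ∑ i, g i u • p i := by
      funext j
      simp [T, p]
    rw [LinearMap.sum_apply, LinearMap.zero_apply, ← hf0 u, hT, map_sum]
    exact Finset.sum_congr rfl fun i _ => by simp [mul_comm]

theorem span_range_eq_top_of_forall_eq_zero (h : ∀ u, (∀ i, g i u = 0) → u = 0) :
    Submodule.span ℝ (range g) = ⊤ := by
  by_contra hne
  obtain ⟨φ, hφ0, hφ⟩ := Submodule.exists_le_ker_of_lt_top _ (lt_top_iff_ne_top.2 hne)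
  obtain ⟨u, rfl⟩ := (Module.evalEquiv ℝ L).surjective φ
  have hu : u = 0 := h u fun i => by
    simpa using hφ (Submodule.subset_span (mem_range_self i))
  exact hφ0 (by rw [hu, map_zero])

end PositiveSpan

/-! ### Gale duality -/

theorem finrank_add_two_le {V : Type*} [AddCommGroup V] [Module ℝ V] {m : ℕ} (g : Fin m → V)
    (hspan : Submodule.span ℝ (range g) = ⊤) (hsum : ∑ i, g i = 0) {c : Fin m → ℝ}
    (hc : ∑ i, c i • g i = 0) {i j : Fin m} (hi : c i = 0) (hj : c j ≠ 0) :
    Module.finrank ℝ V + 2 ≤ m := by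
  let T : (Fin m → ℝ) →ₗ[ℝ] V := Fintype.linearCombination ℝ g
  have h1 := T.finrank_range_add_finrank_ker
  rw [Fintype.range_linearCombination, hspan, finrank_top, Module.finrank_fin_fun] at h1
  -- The constants and `c` are linearly independent dependencies of `g`.
  let p : LinearMap.ker T := ⟨1, by simp [T, Fintype.linearCombination_apply, hsum]⟩
  let q : LinearMap.ker T := ⟨c, by simp [T, Fintype.linearCombination_apply, hc]⟩
  have hli : LinearIndependent ℝ ![p, q] := by
    rw [LinearIndependent.pair_iff]
    intro s t hst
    have h : ∀ r, s + t * c r = 0 := fun r => by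
      simpa [p, q] using congrFun (congrArg Subtype.val hst) r
    have hs : s = 0 := by simpa [hi] using h i
    exact ⟨hs, by simpa [hs, hj] using h j⟩
  have h2 := hli.fintype_card_le_finrank
  rw [Fintype.card_fin] at h2
  omega

/-- A spanning family `g` of `m` vectors with sum zero is the Gale transform of a full-dimensional
configuration `a` of `m` points in dimension `k + 1 = m - dim V - 1`. The linear dependencies of
`g` form a space of dimension `k + 2` that contains the constants; the coordinates of the points
are given by a basis of a complement of the constants. So the dependencies of `g` are exactly the
families of values at `a` of affine functions. -/
theorem exists_isGaleTransform {V : Type*} [AddCommGroup V] [Module ℝ V] [FiniteDimensional ℝ V]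
    {m k : ℕ} (g : Fin m → V) (hspan : Submodule.span ℝ (range g) = ⊤) (hsum : ∑ i, g i = 0)
    (hk : k + 2 + Module.finrank ℝ V = m) :
    ∃ a : Fin m → EuclideanSpace ℝ (Fin (k + 1)), IsGaleTransform a g ∧
      (∀ c : Fin m → ℝ, ∑ i, c i • g i = 0 →
        ∃ (f : StrongDual ℝ (EuclideanSpace ℝ (Fin (k + 1)))) (t : ℝ), ∀ i, c i = t + f (a i)) ∧
      ∀ (f : StrongDual ℝ (EuclideanSpace ℝ (Fin (k + 1)))) (t : ℝ), (∀ i, f (a i) = t) →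
        f = 0 := by
  let T : (Fin m → ℝ) →ₗ[ℝ] V := Fintype.linearCombination ℝ g
  have hT : ∀ c, T c = ∑ i, c i • g i := fun c => Fintype.linearCombination_apply ℝ g c
  obtain ⟨N, hNT⟩ : ∃ N, N = LinearMap.ker T := ⟨_, rfl⟩
  have hNg : ∀ {c}, c ∈ N ↔ ∑ i, c i • g i = 0 := fun {c} => by rw [hNT, LinearMap.mem_ker, hT]
  have hN : Module.finrank ℝ N = k + 2 := by
    rw [hNT]
    have h1 := T.finrank_range_add_finrank_ker
    rw [Fintype.range_linearCombination, hspan, finrank_top, Module.finrank_fin_fun] at h1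
    omega
  have hone : (1 : Fin m → ℝ) ∈ N := by simp [hNg, hsum]
  have hm : (m : ℝ) ≠ 0 := by
    have : m ≠ 0 := by omega
    exact_mod_cast this
  -- The dependencies with coefficient sum zero form a complement `C` of the constants.
  let σ : (Fin m → ℝ) →ₗ[ℝ] ℝ := Fintype.linearCombination ℝ fun _ => 1
  have hσ : ∀ c, σ c = ∑ i, c i := fun c => by simp [σ, Fintype.linearCombination_apply]
  obtain ⟨C, hC⟩ : ∃ C, C = N ⊓ LinearMap.ker σ := ⟨_, rfl⟩
  have hCdim : Module.finrank ℝ C = k + 1 := by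
    have h1 := finrank_map_add_finrank_inf_ker σ N
    have h2 : N.map σ = ⊤ := by
      rw [eq_top_iff]
      intro x _
      exact ⟨(x / m) • 1, N.smul_mem _ hone, by simp [hσ, field]⟩
    rw [h2, finrank_top, Module.finrank_self, ← hC, hN] at h1
    omega
  let n : Module.Basis (Fin (k + 1)) ℝ C := Module.finBasisOfFinrankEq ℝ C hCdim
  let nv : Fin (k + 1) → Fin m → ℝ := fun j => n j
  have hnvC : ∀ j, nv j ∈ N ⊓ LinearMap.ker σ := fun j => hC ▸ (n j).2
  have hval : ∀ (s : Fin (k + 1) → ℝ) (i : Fin m),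
      (∑ j, s j • n j : C).1 i = ∑ j, s j * nv j i := fun s i => by
    simp [nv]
  have hdec : ∀ c ∈ N, ∃ (t : ℝ) (s : Fin (k + 1) → ℝ), ∀ i, c i = t + ∑ j, s j * nv j i := by
    intro c hc
    have hz : c - (σ c / m) • 1 ∈ C := by
      rw [hC]
      refine ⟨N.sub_mem hc (N.smul_mem _ hone), ?_⟩
      change σ _ = 0
      rw [map_sub, map_smul, hσ 1]
      simp [field]
    refine ⟨σ c / m, n.repr ⟨_, hz⟩, fun i => ?_⟩
    rw [← hval, n.sum_repr]
    simp
  let a : Fin m → EuclideanSpace ℝ (Fin (k + 1)) := fun i => WithLp.toLp 2 fun j => nv j i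
  have ha : ∀ i j, a i j = nv j i := fun i j => rfl
  refine ⟨a, ⟨hspan, fun c => ⟨?_, ?_⟩⟩, ?_, ?_⟩
  · rintro ⟨hc0, hca⟩
    -- A family orthogonal to all dependencies of `g` factors through `g`.
    let ψ : Module.Dual ℝ (Fin m → ℝ) := Fintype.linearCombination ℝ c
    have hψ : ψ ∈ N.dualAnnihilator := by
      rw [Submodule.mem_dualAnnihilator]
      intro w hw
      obtain ⟨t, s, hts⟩ := hdec w hw
      have hca' : ∀ j, ∑ i, c i * nv j i = 0 := fun j => by
        have := congrArg (fun q : EuclideanSpace ℝ (Fin (k + 1)) => q j) hca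
        simpa [ha] using this
      simp only [ψ, Fintype.linearCombination_apply, smul_eq_mul, hts, add_mul, Finset.sum_mul,
        Finset.sum_add_distrib]
      rw [← Finset.mul_sum, hc0, mul_zero, zero_add, Finset.sum_comm]
      refine Finset.sum_eq_zero fun j _ => ?_
      rw [← mul_zero (s j), ← hca' j, Finset.mul_sum]
      exact Finset.sum_congr rfl fun i _ => by ring
    rw [hNT, ← LinearMap.range_dualMap_eq_dualAnnihilator_ker] at hψ
    obtain ⟨φ, hφ⟩ := hψ
    refine ⟨φ, fun i => ?_⟩
    have := LinearMap.congr_fun hφ (Pi.single i 1)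
    simpa [ψ, T] using this.symm
  · rintro ⟨φ, hφ⟩
    obtain rfl : c = fun i => φ (g i) := funext hφ
    refine ⟨by rw [← map_sum, hsum, map_zero], ?_⟩
    ext j
    have : ∑ i, φ (g i) * nv j i = φ (∑ i, nv j i • g i) := by
      simp [mul_comm]
    rw [hNg.1 (hnvC j).1, map_zero] at this
    simpa [ha] using this
  · intro c hc
    obtain ⟨t, s, hts⟩ := hdec c (hNg.2 hc)
    refine ⟨∑ j, s j • EuclideanSpace.proj j, t, fun i => ?_⟩
    rw [hts]
    simp [ha]
  · intro f t hft
    let e := EuclideanSpace.basisFun (Fin (k + 1)) ℝ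
    have hf : ∀ x, f x = ∑ j, f (e j) * x j := by
      intro x
      conv_lhs => rw [← e.sum_repr x]
      simp [e, mul_comm]
    have hc : ∀ i, (∑ j, f (e j) • n j : C).1 i = t := fun i => by
      rw [hval, ← hft i, hf]
    -- A constant family with sum zero vanishes.
    have ht : t = 0 := by
      have h0 : σ (∑ j, f (e j) • n j : C).1 = 0 := (hC.le (Subtype.prop _)).2
      rw [hσ, Finset.sum_congr rfl fun i _ => hc i] at h0
      simpa [hm] using h0
    have h0 : ∑ j, f (e j) • n j = 0 := Subtype.ext (funext fun i => (hc i).trans ht)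
    have h1 := Fintype.linearIndependent_iff.1 n.linearIndependent _ h0
    ext x
    rw [hf]
    simp [h1]

/-! ### Simplex faces of a polytope -/

section SimplexFaces

variable {ι E : Type*} [NormedAddCommGroup E] [NormedSpace ℝ E] {a : ι → E} {J : Set ι}

theorem spansSimplexFace_of_forall_le {f : StrongDual ℝ E} {t : ℝ} (hle : ∀ i, f (a i) ≤ t)
    (heq : ∀ i, f (a i) = t ↔ i ∈ J) (hne : ∃ i, i ∉ J)
    (hJ : AffineIndependent ℝ fun i : J => a i) :
    SpansSimplexFace (convexHull ℝ (range a)) a J := by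
  have hle' : ∀ v ∈ range a, f v ≤ t := by rintro _ ⟨i, rfl⟩; exact hle i
  have himage : a '' J = {v ∈ range a | f v = t} := by
    ext v
    constructor
    · rintro ⟨i, hi, rfl⟩
      exact ⟨mem_range_self i, (heq i).2 hi⟩
    · rintro ⟨⟨i, rfl⟩, hi⟩
      exact ⟨i, (heq i).1 hi, rfl⟩
  have hlevel := setOf_mem_convexHull_eq f hle'
  rw [← himage] at hlevel
  have hdef : DefinesFace (convexHull ℝ (range a)) (convexHull ℝ (a '' J)) f t :=
    ⟨fun x hx => le_of_mem_convexHull f hle' hx, hlevel.symm⟩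
  refine ⟨⟨hdef.isFace, fun h => ?_⟩, hJ⟩
  obtain ⟨i, hi⟩ := hne
  have hmem : a i ∈ convexHull ℝ (range a) := subset_convexHull ℝ _ (mem_range_self i)
  rw [← h, ← hlevel] at hmem
  exact hi ((heq i).1 hmem.2)

/-- An affine function takes arbitrary prescribed values at affinely independent points. -/
theorem exists_forall_apply_eq_add [FiniteDimensional ℝ E] (ha : AffineIndependent ℝ a)
    (y : ι → ℝ) : ∃ (f : StrongDual ℝ E) (t : ℝ), ∀ i, f (a i) = y i + t := by
  rcases isEmpty_or_nonempty ι with h | ⟨⟨j⟩⟩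
  · exact ⟨0, 0, fun i => isEmptyElim i⟩
  have hli := (affineIndependent_iff_linearIndependent_vsub ℝ a j).1 ha
  obtain ⟨f, hf⟩ : ∃ f : E →ₗ[ℝ] ℝ, ∀ i : {i // i ≠ j}, f (a i -ᵥ a j) = y i - y j := by
    obtain ⟨f, hf⟩ := LinearMap.exists_extend
      ((Module.Basis.span hli).constr ℝ fun i : {i // i ≠ j} => y i - y j)
    refine ⟨f, fun i => ?_⟩
    have h1 := LinearMap.congr_fun hf (Module.Basis.span hli i)
    rwa [Module.Basis.constr_basis, LinearMap.comp_apply, Submodule.coe_subtype,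
      Module.Basis.span_apply] at h1
  refine ⟨LinearMap.toContinuousLinearMap f, f (a j) - y j, fun i => ?_⟩
  by_cases hi : i = j
  · subst hi; simp
  · have := hf ⟨i, hi⟩
    simp only [vsub_eq_sub, map_sub] at this
    simp only [LinearMap.coe_toContinuousLinearMap']
    linarith

/-- A face of a simplex face is a simplex face. -/
theorem SpansSimplexFace.mono [Finite ι] [FiniteDimensional ℝ E] {τ : Set ι}
    (h : SpansSimplexFace (convexHull ℝ (range a)) a J) (hτ : τ ⊆ J) :
    SpansSimplexFace (convexHull ℝ (range a)) a τ := by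
  classical
  have hind : AffineIndependent ℝ fun i : τ => a i :=
    h.2.comp_embedding (Set.embeddingOfSubset _ _ hτ)
  have hsub : convexHull ℝ (a '' τ) ⊆ convexHull ℝ (a '' J) := convexHull_mono (image_mono hτ)
  refine ⟨⟨IsFace.trans (isPolytope_convexHull (finite_range a)) h.1.1 ?_, fun heq => ?_⟩, hind⟩
  · by_cases hJτ : τ = J
    · rw [hJτ]
      exact IsExposed.refl _
    obtain ⟨f, t, hf⟩ := exists_forall_apply_eq_add h.2
      fun i => if (i : ι) ∈ τ then 0 else -1
    have key := spansSimplexFace_of_forall_le (a := fun i : J => a i) (J := Subtype.val ⁻¹' τ)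
      (f := f) (t := t) (fun i => by rw [hf]; split_ifs <;> linarith)
      (fun i => by
        rw [hf]
        by_cases hi : (i : ι) ∈ τ <;> simp [hi])
      (by
        obtain ⟨i, hi, hiτ⟩ := exists_of_ssubset (hτ.ssubset_of_ne hJτ)
        exact ⟨⟨i, hi⟩, hiτ⟩)
      (h.2.comp_embedding (Function.Embedding.subtype _))
    have h1 : range (fun i : J => a i) = a '' J := by
      rw [image_eq_range]
    have h2 : (fun i : J => a i) '' (Subtype.val ⁻¹' τ) = a '' τ := by
      ext v
      constructor
      · rintro ⟨i, hi, rfl⟩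
        exact ⟨i, hi, rfl⟩
      · rintro ⟨i, hi, rfl⟩
        exact ⟨⟨i, hτ hi⟩, hi, rfl⟩
    rw [h1] at key
    have := key.1.1
    rwa [h2] at this
  · exact h.1.2 (h.1.1.subset.antisymm (heq ▸ hsub))

theorem affineIndependent_of_forall_eq_zero [Fintype ι]
    (h : ∀ c : ι → ℝ, (∀ i ∉ J, c i = 0) → ∑ i, c i = 0 → ∑ i, c i • a i = 0 → c = 0) :
    AffineIndependent ℝ fun i : J => a i := by
  classical
  rw [affineIndependent_iff_of_fintype]
  intro w hw hwa i
  rw [Finset.weightedVSub_eq_linear_combination _ hw] at hwa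
  let c : ι → ℝ := Function.extend Subtype.val w 0
  have hcw : ∀ j : J, c j = w j := fun j => Subtype.val_injective.extend_apply w 0 j
  have hc0 : ∀ j ∉ J, c j = 0 := fun j hj =>
    Function.extend_apply' w (0 : ι → ℝ) j fun ⟨q, hq⟩ => hj (hq ▸ q.2)
  have hc0' : ∀ j ∉ range (Subtype.val : J → ι), c j = 0 := fun j hj =>
    hc0 j (by rwa [Subtype.range_coe] at hj)
  have hc : c = 0 := by
    refine h c hc0 ?_ ?_
    · rw [← hw]
      exact (Fintype.sum_of_injective _ Subtype.val_injective _ _ hc0' fun j => (hcw j).symm).symm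
    · rw [← hwa]
      exact (Fintype.sum_of_injective _ Subtype.val_injective _ _
        (fun j hj => by rw [hc0' j hj, zero_smul]) fun j => by rw [hcw j]).symm
  rw [← hcw i, hc, Pi.zero_apply]

end SimplexFaces

/-! ### Full-dimensional convex bodies and realizations -/

section Realization

variable {E : Type*} [NormedAddCommGroup E] [NormedSpace ℝ E]

theorem vectorSpan_convexHull (S : Set E) : vectorSpan ℝ (convexHull ℝ S) = vectorSpan ℝ S := by
  rw [← direction_affineSpan, affineSpan_convexHull, direction_affineSpan]

theorem vectorSpan_range_eq_top [FiniteDimensional ℝ E] {ι : Type*} {a : ι → E}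
    (h : ∀ (f : StrongDual ℝ E) (t : ℝ), (∀ i, f (a i) = t) → f = 0) :
    vectorSpan ℝ (range a) = ⊤ := by
  by_contra hne
  obtain ⟨f, hf0, hf⟩ := Submodule.exists_le_ker_of_lt_top _ (lt_top_iff_ne_top.2 hne)
  refine hf0 ?_
  rcases isEmpty_or_nonempty ι with hι | ⟨⟨j⟩⟩
  · exact congrArg ContinuousLinearMap.toLinearMap
      (h (LinearMap.toContinuousLinearMap f) 0 fun i => isEmptyElim i)
  · refine congrArg ContinuousLinearMap.toLinearMap
      (h (LinearMap.toContinuousLinearMap f) (f (a j)) fun i => ?_)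
    have h1 : f (a i -ᵥ a j) = 0 := hf (vsub_mem_vectorSpan ℝ (mem_range_self i) (mem_range_self j))
    rw [vsub_eq_sub, map_sub] at h1
    simp only [LinearMap.coe_toContinuousLinearMap']
    linarith

theorem nonempty_frontier_homeomorph_sphere {A : Set E} (hA : Convex ℝ A)
    (hne : (interior A).Nonempty) (hb : Bornology.IsBounded A) :
    Nonempty (frontier A ≃ₜ Metric.sphere (0 : E) 1) := by
  obtain ⟨h, -, -, hfr⟩ := exists_homeomorph_image_interior_closure_frontier_eq_unitBall hA hne hb
  exact ⟨(h.image (frontier A)).trans (Homeomorph.setCongr hfr)⟩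

theorem isCompact_realization {ι : Type*} [Fintype ι] (K : PreAbstractSimplicialComplex ι) :
    IsCompact (realization K) := by
  have : realization K = stdSimplex ℝ ι ∩ ⋃ τ ∈ K.faces, {w | ∀ i, i ∉ τ → w i = 0} := by
    ext w
    simp only [realization, mem_ofPred_eq, mem_inter_iff, mem_iUnion, exists_prop, not_imp_comm,
      ne_eq]
  rw [this]
  refine (isCompact_stdSimplex ℝ ι).inter_right (Set.Finite.isClosed_biUnion (Set.toFinite _) ?_)
  intro τ _
  simp only [ofPred_forall]
  exact isClosed_iInter fun i => isClosed_iInter fun _ =>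
    isClosed_eq (continuous_apply i) continuous_const

end Realization

end PolytopeProjection

/-! ### The projection polytope -/

open PolytopeProjection in
theorem mainTheorem6
    {E W : Type*} [NormedAddCommGroup E] [NormedSpace ℝ E] [FiniteDimensional ℝ E]
    [NormedAddCommGroup W] [NormedSpace ℝ W] [FiniteDimensional ℝ W]
    (d e m : ℕ) (P : Set E) (π : E →ᵃ[ℝ] W) (F : Fin m → Set E)
    (hP : PolytopeProjection.IsPolytope P)
    (hd : PolytopeProjection.polyDim P = d)
    (he : PolytopeProjection.polyDim (π '' P) = e)
    (hF : PolytopeProjection.IsFacetEnumeration P F)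
    (hvert : ∀ v, PolytopeProjection.IsVertex P v → PolytopeProjection.StrictlyPreserved P π v) :
    ∃ k : ℕ, (k : ℤ) = (m : ℤ) - d - 2 + e ∧
      ∃ (A : Set (EuclideanSpace ℝ (Fin (k + 1))))
        (a : Fin m → EuclideanSpace ℝ (Fin (k + 1)))
        (l : Fin m → StrongDual ℝ E) (b : Fin m → ℝ),
        -- `A` is a `(k + 1)`-polytope with the `m` distinct vertices `a i`
        A = convexHull ℝ (range a) ∧
        PolytopeProjection.polyDim A = (k : ℤ) + 1 ∧
        Function.Injective a ∧
        (∀ v, PolytopeProjection.IsVertex A v ↔ ∃ i, v = {a i}) ∧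
        -- `A` is Gale-dual to the facet normals of `P`, restricted to the fibre direction of `π`
        (∀ i, PolytopeProjection.DefinesFace P (F i) (l i) (b i)) ∧
        PolytopeProjection.IsGaleTransform a
          (fun i => (l i : E →ₗ[ℝ] ℝ).domRestrict (PolytopeProjection.fibreDirection P π)) ∧
        -- strictly preserved faces give simplex faces of `A`
        (∀ G, PolytopeProjection.StrictlyPreserved P π G →
          PolytopeProjection.SpansSimplexFace A a (PolytopeProjection.facetIncidences F G)ᶜ) ∧
        -- the boundary of `A` is a `k`-sphere
        Nonempty (frontier A ≃ₜ Metric.sphere (0 : EuclideanSpace ℝ (Fin (k + 1))) 1) ∧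
        -- the strict projection complex is embedded, simplex by simplex, in the boundary of `A`
        (∀ τ ∈ (PolytopeProjection.strictProjectionComplex P π F).faces,
          PolytopeProjection.SpansSimplexFace A a (τ : Set (Fin m))) ∧
        (∀ w ∈ PolytopeProjection.realization (PolytopeProjection.strictProjectionComplex P π F),
          ∑ i, w i • a i ∈ frontier A) ∧
        Topology.IsEmbedding
          (fun w : PolytopeProjection.realization
              (PolytopeProjection.strictProjectionComplex P π F) =>
            ∑ i, (w : Fin m → ℝ) i • a i) := by
  classical
  -- The hypothesis on the vertices excludes `d = 0`, so that the facets are nonempty.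
  have hPne : P.Nonempty := polyDim_nonneg_iff.1 (by rw [hd]; positivity)
  have hd1 : 1 ≤ d := by
    by_contra h
    have hPv : IsVertex P P := ⟨IsExposed.refl _, by rw [hd]; omega⟩
    exact (hvert P hPv).isProperFace.2 rfl
  have hFi : ∀ i, IsFacet P (F i) := fun i => by
    have : F i ∈ range F := mem_range_self i
    rwa [hF.2] at this
  have hFne : ∀ i, (F i).Nonempty := fun i => polyDim_nonneg_iff.1 (by
    rw [(hFi i).2, hd]; omega)
  have hFproper : ∀ i, IsProperFace P (F i) := fun i =>
    ⟨(hFi i).1, fun h => by have := (hFi i).2; rw [h] at this; omega⟩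
  choose l₀ b₀ hl₀ using fun i => (hFi i).1.exists_definesFace (hFne i)
  obtain ⟨x₀, hx₀⟩ := hP.exists_isVertex hPne
  have hS₀ := hvert _ hx₀
  let L := fibreDirection P π
  -- Rescale the facet normals so that their restrictions to the fibre direction sum to zero.
  obtain ⟨c₀, hc₀, -, hc₀sum⟩ := exists_pos_dependency
    (g := fun i => (l₀ i : E →ₗ[ℝ] ℝ).domRestrict L) univ fun u hu =>
      Subtype.ext (hS₀.eq_zero_of_forall_le hP hF hl₀ (singleton_nonempty _) u.2
        fun i _ => hu i (mem_univ i))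
  let l : Fin m → StrongDual ℝ E := fun i => c₀ i • l₀ i
  let b : Fin m → ℝ := fun i => c₀ i * b₀ i
  have hl : ∀ i, DefinesFace P (F i) (l i) (b i) := by
    intro i
    have hc := hc₀ i (mem_univ i)
    refine ⟨fun x hx => mul_le_mul_of_nonneg_left ((hl₀ i).1 x hx) hc.le, ?_⟩
    rw [(hl₀ i).2]
    ext x
    exact and_congr_right fun _ => (mul_right_inj' hc.ne').symm
  let g : Fin m → L →ₗ[ℝ] ℝ := fun i => (l i : E →ₗ[ℝ] ℝ).domRestrict L
  have hgsum : ∑ i, g i = 0 := by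
    rw [← hc₀sum]
    exact Finset.sum_congr rfl fun i _ => rfl
  have hkey : ∀ G, StrictlyPreserved P π G → G.Nonempty → ∀ u : L,
      (∀ i ∈ facetIncidences F G, g i u ≤ 0) → u = 0 := fun G hG hne u hu =>
    Subtype.ext (hG.eq_zero_of_forall_le hP hF hl hne u.2 hu)
  have hspan : Submodule.span ℝ (range g) = ⊤ := span_range_eq_top_of_forall_eq_zero fun u hu =>
    hkey _ hS₀ (singleton_nonempty _) u fun i _ => (hu i).le
  have hmiss : ∀ i, ∃ G, StrictlyPreserved P π G ∧ G.Nonempty ∧ i ∉ facetIncidences F G := by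
    intro i
    obtain ⟨x, hx, hxF⟩ := (hFproper i).exists_isVertex_notMem hP (hFne i)
    exact ⟨{x}, hvert _ hx, singleton_nonempty x, fun h => hxF (h (mem_singleton x))⟩
  -- Every strictly preserved face gives a dependency supported on its facet incidences.
  have hdep : ∀ G, StrictlyPreserved P π G → G.Nonempty → ∃ c : Fin m → ℝ,
      (∀ i ∈ facetIncidences F G, 0 < c i) ∧ (∀ i ∉ facetIncidences F G, c i = 0) ∧
        ∑ i, c i • g i = 0 := fun G hG hne => exists_pos_dependency _ (hkey G hG hne)
  have hinc : ∀ G, StrictlyPreserved P π G → G.Nonempty → (facetIncidences F G).Nonempty :=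
    fun G hG hne => hG.isProperFace.facetIncidences_nonempty hP hF hl hne
  have hm : Module.finrank ℝ L + 2 ≤ m := by
    obtain ⟨j, -⟩ := hinc _ hS₀ (singleton_nonempty _)
    obtain ⟨G, hG, hne, hjG⟩ := hmiss j
    obtain ⟨i, hi⟩ := hinc G hG hne
    obtain ⟨c, hcpos, hc0, hcsum⟩ := hdep G hG hne
    have := finrank_add_two_le g hspan hgsum hcsum (hc0 j hjG) (hcpos i hi).ne'
    rwa [Subspace.dual_finrank_eq] at this
  obtain ⟨k, hk⟩ := Nat.exists_eq_add_of_le hm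
  have hLdim : e + Module.finrank ℝ L = d := by
    have h1 := finrank_fibreDirection_add P π
    rw [polyDim_of_nonempty hPne] at hd
    rw [polyDim_of_nonempty (hPne.image π)] at he
    change _ + Module.finrank ℝ L = _ at h1
    omega
  obtain ⟨a, hGale, hval, hconst⟩ := exists_isGaleTransform (k := k) g hspan hgsum (by
    rw [Subspace.dual_finrank_eq]; omega)
  refine ⟨k, by omega, convexHull ℝ (range a), a, l, b, rfl, ?_⟩
  set A := convexHull ℝ (range a) with hA
  have haA : ∀ i, a i ∈ A := fun i => subset_convexHull ℝ _ (mem_range_self i)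
  have hspanA : vectorSpan ℝ A = ⊤ := by
    rw [hA, vectorSpan_convexHull, vectorSpan_range_eq_top hconst]
  have : Nonempty (Fin m) := ⟨⟨0, by omega⟩⟩
  have hAne : A.Nonempty := ⟨_, haA (Classical.arbitrary _)⟩
  have hAcomp : IsCompact A := (finite_range a).isCompact_convexHull ℝ
  -- The dependency of a strictly preserved face, read as an affine function on `A`.
  have hsupp : ∀ G, StrictlyPreserved P π G → G.Nonempty →
      ∃ (f : StrongDual ℝ (EuclideanSpace ℝ (Fin (k + 1)))) (t : ℝ),
        (∀ i, f (a i) ≤ t) ∧ ∀ i, f (a i) = t ↔ i ∈ (facetIncidences F G)ᶜ := by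
    intro G hG hne
    obtain ⟨c, hcpos, hc0, hcsum⟩ := hdep G hG hne
    obtain ⟨f, t, hft⟩ := hval c hcsum
    have hf : ∀ i, (-f) (a i) = t - c i := fun i => by
      rw [hft i, neg_apply]; ring
    refine ⟨-f, t, fun i => ?_, fun i => ?_⟩
    · rw [hf]
      by_cases hi : i ∈ facetIncidences F G
      · linarith [hcpos i hi]
      · linarith [hc0 i hi]
    · rw [hf]
      constructor
      · intro h hi
        linarith [hcpos i hi]
      · intro hi
        rw [hc0 i hi, sub_zero]
  -- By Gale duality, an affine dependency supported off the incidences of `G` is given by a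
  -- vector of `L` that is orthogonal to the normals of the facets containing `G`.
  have huniq : ∀ G, StrictlyPreserved P π G → G.Nonempty → ∀ c : Fin m → ℝ,
      (∀ i ∉ (facetIncidences F G)ᶜ, c i = 0) → ∑ i, c i = 0 → ∑ i, c i • a i = 0 → c = 0 := by
    intro G hG hne c hc h1 h2
    obtain ⟨φ, hφ⟩ := (hGale.2 c).1 ⟨h1, h2⟩
    obtain ⟨u, rfl⟩ := (Module.evalEquiv ℝ L).surjective φ
    have hu : u = 0 := hkey G hG hne u fun i hi => by
      have h := hφ i
      rw [hc i (not_not.2 hi)] at h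
      exact h.ge
    funext i
    rw [hφ i, hu]
    simp
  have hface : ∀ G, StrictlyPreserved P π G → G.Nonempty →
      SpansSimplexFace A a (facetIncidences F G)ᶜ := by
    intro G hG hne
    obtain ⟨f, t, hle, heq⟩ := hsupp G hG hne
    obtain ⟨i, hi⟩ := hinc G hG hne
    exact spansSimplexFace_of_forall_le hle heq ⟨i, not_not.2 hi⟩
      (affineIndependent_of_forall_eq_zero (huniq G hG hne))
  have hface' : ∀ G, StrictlyPreserved P π G →
      SpansSimplexFace A a (facetIncidences F G)ᶜ := by
    intro G hG
    rcases G.eq_empty_or_nonempty with rfl | hne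
    · exact (hface _ hS₀ (singleton_nonempty _)).mono fun i hi => absurd (empty_subset _) hi
    · exact hface G hG hne
  have hK : ∀ τ ∈ (strictProjectionComplex P π F).faces,
      SpansSimplexFace A a (τ : Set (Fin m)) := by
    rintro τ ⟨-, G, hG, hτ⟩
    exact (hface' G hG).mono hτ
  -- Nonempty simplices of the complex come from nonempty faces.
  have hKne : ∀ τ ∈ (strictProjectionComplex P π F).faces, ∃ G, StrictlyPreserved P π G ∧
      G.Nonempty ∧ (τ : Set (Fin m)) ⊆ (facetIncidences F G)ᶜ := by
    rintro τ ⟨⟨i, hi⟩, G, hG, hτ⟩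
    refine ⟨G, hG, nonempty_iff_ne_empty.2 ?_, hτ⟩
    rintro rfl
    exact hτ hi (empty_subset _)
  have hinj : Function.Injective a := by
    intro i j hij
    by_contra hne
    obtain ⟨G, hG, hGne, hi⟩ := hmiss i
    obtain ⟨f, t, -, heq⟩ := hsupp G hG hGne
    have hj : j ∈ (facetIncidences F G)ᶜ := (heq j).1 (hij ▸ (heq i).2 hi)
    have h := huniq G hG hGne (Pi.single i 1 - Pi.single j 1) (fun r hr => by
      have hri : r ≠ i := fun h => hr (h ▸ hi)
      have hrj : r ≠ j := fun h => hr (h ▸ hj)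
      simp [hri, hrj]) (by simp) (by
      simp [sub_smul, Finset.sum_sub_distrib, Pi.single_apply, hij])
    have := congrFun h i
    simp [hne] at this
  refine ⟨?_, hinj, ?_, hl, hGale, hface', ?_, hK, ?_, ?_⟩
  · rw [polyDim_of_nonempty hAne, hspanA, finrank_top, finrank_euclideanSpace_fin]
    push_cast
    ring
  · intro v
    constructor
    · rintro ⟨hv, hv0⟩
      obtain ⟨x, rfl⟩ := exists_eq_singleton_of_polyDim_eq_zero hv0
      obtain ⟨i, rfl⟩ := extremePoints_convexHull_subset (isExtreme_singleton.1 hv.isExtreme)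
      exact ⟨i, rfl⟩
    · rintro ⟨i, rfl⟩
      obtain ⟨G, hG, hne, hi⟩ := hmiss i
      have h := ((hface G hG hne).mono (singleton_subset_iff.2 hi)).1.1
      rw [image_singleton, convexHull_singleton] at h
      exact ⟨h, polyDim_singleton _⟩
  · refine nonempty_frontier_homeomorph_sphere (convex_convexHull ℝ _) ?_ hAcomp.isBounded
    rw [hA, interior_convexHull_nonempty_iff_affineSpan_eq_top,
      ← (affineSpan ℝ (range a)).direction_eq_top_iff_of_nonempty, direction_affineSpan,
      vectorSpan_range_eq_top hconst]
    exact (affineSpan_nonempty ℝ).2 (range_nonempty a)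
  · rintro w ⟨⟨hw0, hw1⟩, τ, hτ, hwτ⟩
    obtain ⟨G, hG, hne, hτG⟩ := hKne τ hτ
    obtain ⟨f, t, hle, heq⟩ := hsupp G hG hne
    have hxA : ∑ i, w i • a i ∈ A :=
      (convex_convexHull ℝ _).sum_mem (fun i _ => hw0 i) hw1 fun i _ => haA i
    have hfx : f (∑ i, w i • a i) = t := by
      rw [map_sum, ← one_mul t, ← hw1, Finset.sum_mul]
      refine Finset.sum_congr rfl fun i _ => ?_
      rw [map_smul, smul_eq_mul]
      by_cases hi : w i = 0
      · rw [hi, zero_mul, zero_mul]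
      · rw [(heq i).2 (hτG (hwτ i hi))]
    rw [hAcomp.isClosed.frontier_eq]
    refine ⟨hxA, fun hint => ?_⟩
    -- A nonzero functional has no maximum in the interior.
    have hmax : IsLocalMax f (∑ i, w i • a i) := by
      filter_upwards [mem_interior_iff_mem_nhds.1 hint] with y hy
      rw [hfx]
      exact le_of_mem_convexHull f (by rintro _ ⟨i, rfl⟩; exact hle i) hy
    have hf0 : f = 0 := by
      have := hmax.fderiv_eq_zero
      rwa [f.fderiv] at this
    obtain ⟨i, hi⟩ := hinc G hG hne
    refine absurd ((heq i).1 ?_) (not_not.2 hi)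
    rw [← hfx, hf0]
    rfl
  · have : CompactSpace (realization (strictProjectionComplex P π F)) :=
      isCompact_iff_compactSpace.1 (isCompact_realization _)
    refine (Continuous.isClosedEmbedding (continuous_finsetSum _ fun i _ =>
      ((continuous_apply i).comp continuous_subtype_val).smul continuous_const) ?_).isEmbedding
    rintro ⟨w, ⟨hw0, hw1⟩, τ, hτ, hwτ⟩ ⟨w', ⟨hw0', hw1'⟩, τ', hτ', hwτ'⟩ hww
    change ∑ i, w i • a i = ∑ i, w' i • a i at hww
    apply Subtype.ext
    change w = w'
    obtain ⟨G, hG, hne, hτG⟩ := hKne τ hτ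
    obtain ⟨f, t, hle, heq⟩ := hsupp G hG hne
    have hwG : ∀ i ∈ facetIncidences F G, w i = 0 := fun i hi => by
      by_contra h
      exact hτG (hwτ i h) hi
    -- The image point lies on the face of `G`, so `w'` is supported there as well.
    have hsum : ∀ v : Fin m → ℝ, ∑ i, v i = 1 →
        t - f (∑ i, v i • a i) = ∑ i, v i * (t - f (a i)) := by
      intro v hv
      simp [mul_sub, Finset.sum_sub_distrib, ← Finset.sum_mul, hv]
    have hz : ∑ i, w' i * (t - f (a i)) = 0 := by
      rw [← hsum w' hw1', ← hww, hsum w hw1]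
      refine Finset.sum_eq_zero fun i _ => ?_
      by_cases hi : i ∈ facetIncidences F G
      · rw [hwG i hi, zero_mul]
      · rw [(heq i).2 hi, sub_self, mul_zero]
    rw [Finset.sum_eq_zero_iff_of_nonneg fun i _ =>
      mul_nonneg (hw0' i) (sub_nonneg.2 (hle i))] at hz
    have hwG' : ∀ i ∈ facetIncidences F G, w' i = 0 := fun i hi => by
      refine (mul_eq_zero.1 (hz i (Finset.mem_univ i))).resolve_right fun h => ?_
      exact (heq i).1 (sub_eq_zero.1 h).symm hi
    have h0 : w - w' = 0 := huniq G hG hne (w - w')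
      (fun i hi => by
        have hi' := not_not.1 hi
        rw [Pi.sub_apply, hwG i hi', hwG' i hi', sub_zero])
      (by simp [Finset.sum_sub_distrib, hw1, hw1'])
      (by simp [sub_smul, Finset.sum_sub_distrib, hww])
    exact sub_eq_zero.1 h0
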